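/- **Proposition (1-skeleton and weak order).** Let $V$ be a finite-dimensional real Euclidean space and $W\subseteq O(V)$ a finite reflection group, that is, a finite subgroup generated by orthogonal reflections $s_\alpha$ (the reflection in the hyperplane $\alpha^\perp$, $\alpha\neq 0$). Let $\Phi$ be a root system for $W$: a finite set of nonzero vectors, stable under $W$, such that $W=\langle s_\alpha \mid \alpha\in\Phi\rangle$ and $\mathbb R\alpha\cap\Phi=\{\alpha,-\alpha\}$ for every $\alpha\in\Phi$. Let $\boldsymbol a\in V$ be generic, i.e. fixed by no reflection of $W$, and let $\Delta$ be the simple system of $\Phi$ with $\langle \boldsymbol a,\alpha\rangle>0$ for all $\alpha\in\Delta$; here a simple system is a minimal subset of $\Phi^+$ generating the same convex cone as $\Phi^+$, where $\Phi^+$ is the set of roots on one side of a linear hyperplane that contains no root. Put $S=\{s_\alpha\mid\alpha\in\Delta\}$, let $\ell(w)$ be the minimal number of letters of a word in $S$ expressing $w\in W$, and let $\mathrm{Perm}^{\boldsymbol a}(W)=\mathrm{conv}\{w(\boldsymbol a)\mid w\in W\}$. The right weak order on $W$ is the relation $u\le v$ defined by $\ell(v)=\ell(u)+\ell(u^{-1}v)$.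 Then: 1. The right weak order is a partial order on $W$ and a lattice. 2. The map $w\mapsto w(\boldsymbol a)$ is a bijection from $W$ onto the vertex set of $\mathrm{Perm}^{\boldsymbol a}(W)$. Whenever the segment $[u(\boldsymbol a),v(\boldsymbol a)]$ is an edge, $\ell(u)\ne\ell(v)$; and if every edge is oriented from the endpoint of smaller length to the endpoint of larger length, the oriented $1$-skeleton (vertices and oriented edges) is the Hasse diagram of the right weak order: for $u,v\in W$ there is an oriented edge from $u(\boldsymbol a)$ to $v(\boldsymbol a)$ if and only if $v$ covers $u$. 3. The minimum of the right weak order is the identity $e$, and it has a maximum $w_o$, which is the unique element of maximal length. 4. For each nonempty face $F$ of $\mathrm{Perm}^{\boldsymbol a}(W)$ there are $u\le v$ in $W$ such that $\{w\in W\mid w(\boldsymbol a)\in F\}$ is the interval $[u,v]=\{w\mid u\le w\le v\}$, and $F=\mathrm{conv}\{w(\boldsymbol a)\mid w\in[u,v]\}$. -/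

import Mathlib

namespace CoxeterPerm

noncomputable section

variable {V : Type*} [NormedAddCommGroup V] [InnerProductSpace ℝ V]

/-- The orthogonal reflection `s_α`: it fixes the hyperplane `α^⊥` pointwise and maps `α` to `-α`. -/
def reflAlong (α : V) : V ≃ₗᵢ[ℝ] V := (ℝ ∙ α)ᗮ.reflection

/-- `g` is a reflection, i.e. `g = s_α` for some nonzero vector `α`. -/
def IsReflection (g : V ≃ₗᵢ[ℝ] V) : Prop := ∃ α : V, α ≠ 0 ∧ g = reflAlong α

/-- `W` is generated by the reflections it contains. -/
def IsReflectionGroup (W : Subgroup (V ≃ₗᵢ[ℝ] V)) : Prop :=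
  Subgroup.closure {g | g ∈ W ∧ IsReflection g} = W

/-- `Φ` is a root system for `W`. The empty set is allowed: it is the root system of the trivial
group. -/
structure IsRootSystem (W : Subgroup (V ≃ₗᵢ[ℝ] V)) (Φ : Set V) : Prop where
  finite : Φ.Finite
  ne_zero : ∀ α ∈ Φ, α ≠ 0
  closure_eq : Subgroup.closure (reflAlong '' Φ) = W
  line_inter : ∀ α ∈ Φ, (Submodule.span ℝ {α} : Set V) ∩ Φ = {α, -α}
  stable : ∀ w ∈ W, ∀ α ∈ Φ, w α ∈ Φ

/-- `P` is the set of roots on the positive side of a linear hyperplane that contains no root. -/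
def IsPositiveSystem (Φ P : Set V) : Prop :=
  ∃ f : V →ₗ[ℝ] ℝ, (∀ α ∈ Φ, f α ≠ 0) ∧ P = {α ∈ Φ | 0 < f α}

/-- `Δ` is a simple system of `Φ`: for some positive system `P`, it is an inclusion-minimal subset
of `P` generating the same convex cone as `P`. -/
def IsSimpleSystem (Φ Δ : Set V) : Prop :=
  ∃ P : Set V, IsPositiveSystem Φ P ∧
    Minimal (fun D : Set V => D ⊆ P ∧ PointedCone.hull ℝ D = PointedCone.hull ℝ P) Δ

/-- A point is generic if it is fixed by no reflection of `W`. -/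
def IsGeneric (W : Subgroup (V ≃ₗᵢ[ℝ] V)) (a : V) : Prop :=
  ∀ g ∈ W, IsReflection g → g a ≠ a

/-- The permutahedron: the convex hull of the `W`-orbit of `a`. -/
def perm (W : Subgroup (V ≃ₗᵢ[ℝ] V)) (a : V) : Set V :=
  convexHull ℝ (Set.range fun w : W => (w : V ≃ₗᵢ[ℝ] V) a)

/-- The set `S` of simple reflections `s_α`, `α ∈ Δ`, as elements of `W`. -/
def simpleReflections (W : Subgroup (V ≃ₗᵢ[ℝ] V)) (Δ : Set V) : Set W :=
  {s | ∃ α ∈ Δ, (s : V ≃ₗᵢ[ℝ] V) = reflAlong α}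

/-- The least number of letters of a word in the alphabet `S` that expresses `w`. -/
def length {G : Type*} [Group G] (S : Set G) (w : G) : ℕ :=
  sInf {n | ∃ l : List G, (∀ s ∈ l, s ∈ S) ∧ l.prod = w ∧ l.length = n}

/-- The right weak order: `v` is a product `u * x` with `ℓ(v) = ℓ(u) + ℓ(x)`. -/
def RightWeakLE {G : Type*} [Group G] (S : Set G) (u v : G) : Prop :=
  ∃ x : G, v = u * x ∧ length S v = length S u + length S x

/-- A nonempty face of `P`: the set of maximizers on `P` of a linear functional (the zero
functional gives `P` itself). -/
def IsFace (P F : Set V) : Prop := F.Nonempty ∧ IsExposed ℝ P F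

/-- An edge is a face of dimension one, the dimension being that of the affine span. -/
def IsEdge (P F : Set V) : Prop := IsFace P F ∧ Module.finrank ℝ (vectorSpan ℝ F) = 1

/-- The 1-skeleton of `P`: its nodes are the vertices of `P` (the points `x` such that `{x}` is a
face), and two vertices are adjacent if the segment joining them is an edge of `P`. -/
def oneSkeleton (P : Set V) : SimpleGraph (P.exposedPoints ℝ) where
  Adj x y := IsEdge P (segment ℝ (x : V) (y : V))
  symm := ⟨fun x y h => by rwa [segment_symm]⟩
  loopless := ⟨fun x h => by
    have h2 : Module.finrank ℝ (vectorSpan ℝ (segment ℝ (x : V) (x : V))) = 1 := h.2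
    rw [segment_same, vectorSpan_singleton, finrank_bot] at h2
    exact zero_ne_one h2⟩

end

end CoxeterPerm

/-!
Encode `w` by its inversion set: the roots that are positive at `a` and negative at `w a`. The
exchange condition shows that `ℓ w` is the number of inversions, and then that the right weak order
is inclusion of inversion sets.

A linear functional `f` is maximal at `w a` on the orbit if and only if, among the positive roots,
`{f < 0} ⊆ inversions w ⊆ {f ≤ 0}`. Both bounds are inversion sets, as one sees by perturbing `f` by
a small multiple of `⟪a, ·⟫` or of `-⟪a, ·⟫`; hence the vertices of a face form an interval. If the
interval has just two elements, they differ by a simple reflection on the right.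

For the lattice property it suffices, in a finite order with a least element, that two covers of a
common element `u` have a join. Let the covers be `u * s_α` and `u * s_β`. Choose `f ≥ 0` on `Δ`
vanishing exactly at `α` and `β` among the simple roots; the join is the top of the face in
direction `f ∘ u⁻¹`. Indeed a positive root `γ` with `f (u⁻¹ γ) ≤ 0` is an inversion of `u` or lies
in the cone of `u α` and `u β`, so it is an inversion of every common upper bound.
-/

namespace CoxeterPerm

open scoped RealInnerProductSpace

/-! ### Word length and the right weak order -/

section WordLength

variable {G : Type*} [Group G] {S : Set G}

theorem length_prod_le {l : List G} (hl : ∀ s ∈ l, s ∈ S) : length S l.prod ≤ l.length :=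
  Nat.sInf_le ⟨l, hl, rfl, rfl⟩

theorem exists_list_length_eq (hS : Submonoid.closure S = ⊤) (w : G) :
    ∃ l : List G, (∀ s ∈ l, s ∈ S) ∧ l.prod = w ∧ l.length = length S w := by
  obtain ⟨l, hl, hw⟩ := Submonoid.exists_list_of_mem_closure (hS.ge (Submonoid.mem_top w))
  exact Nat.sInf_mem (s := {n | ∃ l : List G, (∀ s ∈ l, s ∈ S) ∧ l.prod = w ∧ l.length = n})
    ⟨_, l, hl, hw, rfl⟩

@[simp]
theorem length_one : length S (1 : G) = 0 :=
  Nat.le_zero.1 (length_prod_le (l := []) (by simp))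

theorem length_le_one {s : G} (hs : s ∈ S) : length S s ≤ 1 := by
  simpa using length_prod_le (l := [s]) (by simpa using hs)

theorem length_eq_zero (hS : Submonoid.closure S = ⊤) {w : G} : length S w = 0 ↔ w = 1 := by
  refine ⟨fun h => ?_, by rintro rfl; exact length_one⟩
  obtain ⟨l, -, rfl, hl⟩ := exists_list_length_eq hS w
  rw [List.length_eq_zero_iff.1 (hl.trans h), List.prod_nil]

theorem length_mul_le (hS : Submonoid.closure S = ⊤) (u v : G) :
    length S (u * v) ≤ length S u + length S v := by
  obtain ⟨l, hl, rfl, hlu⟩ := exists_list_length_eq hS u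
  obtain ⟨m, hm, rfl, hmv⟩ := exists_list_length_eq hS v
  rw [← hlu, ← hmv, ← List.length_append, ← List.prod_append]
  exact length_prod_le fun s hs => (List.mem_append.1 hs).elim (hl s) (hm s)

theorem exists_eq_mul_left (hS : Submonoid.closure S = ⊤) {w : G} (hw : w ≠ 1) :
    ∃ s ∈ S, ∃ x, w = s * x ∧ length S w = length S x + 1 := by
  obtain ⟨_ | ⟨s, l⟩, hl, rfl, hlen⟩ := exists_list_length_eq hS w
  · exact absurd List.prod_nil hw
  have hs : s ∈ S := hl s (by simp)
  have hle : length S l.prod ≤ l.length := length_prod_le fun t ht => hl t (by simp [ht])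
  have hmul := length_mul_le hS s l.prod
  have hs1 := length_le_one hs
  rw [List.prod_cons, List.length_cons] at hlen
  exact ⟨s, hs, l.prod, List.prod_cons, by rw [List.prod_cons]; lia⟩

theorem exists_eq_mul_right (hS : Submonoid.closure S = ⊤) {w : G} (hw : w ≠ 1) :
    ∃ s ∈ S, ∃ x, w = x * s ∧ length S w = length S x + 1 := by
  obtain ⟨l, hl, rfl, hlen⟩ := exists_list_length_eq hS w
  obtain rfl | ⟨l, s, rfl⟩ := l.eq_nil_or_concat'
  · exact absurd List.prod_nil hw
  have hs : s ∈ S := hl s (by simp)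
  have hle : length S l.prod ≤ l.length := length_prod_le fun t ht => hl t (by simp [ht])
  have hmul := length_mul_le hS l.prod s
  have hs1 := length_le_one hs
  have hprod : (l ++ [s]).prod = l.prod * s := by simp
  rw [hprod, List.length_append, List.length_singleton] at hlen
  exact ⟨s, hs, l.prod, hprod, by rw [hprod]; lia⟩

theorem length_induction_left (hS : Submonoid.closure S = ⊤) {p : G → Prop} (one : p 1)
    (mul : ∀ s ∈ S, ∀ x, length S (s * x) = length S x + 1 → p x → p (s * x)) (w : G) : p w := by
  induction hn : length S w generalizing w with
  | zero => exact (length_eq_zero hS).1 hn ▸ one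
  | succ n ih =>
    have hw : w ≠ 1 := by rintro rfl; simp at hn
    obtain ⟨s, hs, x, rfl, hx⟩ := exists_eq_mul_left hS hw
    exact mul s hs x hx (ih x (by lia))

theorem length_induction_right (hS : Submonoid.closure S = ⊤) {p : G → Prop} (one : p 1)
    (mul : ∀ x, ∀ s ∈ S, length S (x * s) = length S x + 1 → p x → p (x * s)) (w : G) : p w := by
  induction hn : length S w generalizing w with
  | zero => exact (length_eq_zero hS).1 hn ▸ one
  | succ n ih =>
    have hw : w ≠ 1 := by rintro rfl; simp at hn
    obtain ⟨s, hs, x, rfl, hx⟩ := exists_eq_mul_right hS hw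
    exact mul x s hs hx (ih x (by lia))

theorem rightWeakLE_iff {u v : G} :
    RightWeakLE S u v ↔ length S v = length S u + length S (u⁻¹ * v) := by
  refine ⟨?_, fun h => ⟨u⁻¹ * v, (mul_inv_cancel_left u v).symm, h⟩⟩
  rintro ⟨x, rfl, h⟩
  rwa [inv_mul_cancel_left]

theorem length_lt_length [PartialOrder G] (hS : Submonoid.closure S = ⊤)
    (hle : ∀ u v : G, u ≤ v ↔ RightWeakLE S u v) {u v : G} (huv : u < v) :
    length S u < length S v := by
  have h := rightWeakLE_iff.1 ((hle u v).1 huv.le)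
  have hne : length S (u⁻¹ * v) ≠ 0 := by
    rw [Ne, length_eq_zero hS, inv_mul_eq_one]
    exact huv.ne
  lia

theorem covBy_iff [PartialOrder G] (hS : Submonoid.closure S = ⊤)
    (hle : ∀ u v : G, u ≤ v ↔ RightWeakLE S u v) {u v : G} :
    u ⋖ v ↔ ∃ s ∈ S, v = u * s ∧ length S u < length S v := by
  constructor
  · intro huv
    have hlt := length_lt_length hS hle huv.lt
    obtain ⟨w, rfl, hw⟩ := (hle u v).1 huv.le
    have hw1 : w ≠ 1 := by rintro rfl; simp at hlt
    obtain ⟨s, hs, x, rfl, hx⟩ := exists_eq_mul_left hS hw1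
    have hus := length_mul_le hS u s
    have husx := length_mul_le hS (u * s) x
    have hs1 := length_le_one hs
    rw [mul_assoc] at husx
    have hlt' : u < u * s := by
      refine lt_of_le_of_ne ((hle _ _).2 ⟨s, rfl, by lia⟩) fun h => ?_
      rw [← h] at husx
      lia
    have hle' : u * s ≤ u * (s * x) := (hle _ _).2 ⟨x, (mul_assoc _ _ _).symm, by lia⟩
    exact ⟨s, hs, (hle'.eq_of_not_lt fun h => huv.2 hlt' h).symm, hlt⟩
  · rintro ⟨s, hs, rfl, hlt⟩
    have hus := length_mul_le hS u s
    have hs1 := length_le_one hs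
    have hule : u ≤ u * s := (hle _ _).2 ⟨s, rfl, by lia⟩
    refine ⟨hule.lt_of_ne fun h => hlt.ne (congrArg _ h), fun c huc hcu => ?_⟩
    have h1 := length_lt_length hS hle huc
    have h2 := length_lt_length hS hle hcu
    lia

end WordLength

/-! ### Lattices from joins of covers -/

section Lattice

variable {α : Type*} [PartialOrder α]

theorem isLUB_pair_iff {x y j : α} : IsLUB {x, y} j ↔ ∀ b, j ≤ b ↔ x ≤ b ∧ y ≤ b := by
  simp [isLUB_iff_le_iff]

theorem exists_isLUB_pair_of_covBy [WellFoundedGT α] [IsStronglyAtomic α]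
    (hcov : ∀ u x y : α, u ⋖ x → u ⋖ y → ∃ j, IsLUB {x, y} j) {u x y : α} (hux : u ≤ x)
    (huy : u ≤ y) : ∃ j, IsLUB {x, y} j := by
  simp only [isLUB_pair_iff] at hcov ⊢
  induction u using WellFoundedGT.induction generalizing x y with
  | _ u ih =>
    rcases hux.eq_or_lt with rfl | hux
    · exact ⟨y, fun b => ⟨fun h => ⟨huy.trans h, h⟩, And.right⟩⟩
    rcases huy.eq_or_lt with rfl | huy
    · exact ⟨x, fun b => ⟨fun h => ⟨h, hux.le.trans h⟩, And.left⟩⟩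
    obtain ⟨x', hux', hx'⟩ := exists_covBy_le_of_lt hux
    obtain ⟨y', huy', hy'⟩ := exists_covBy_le_of_lt huy
    obtain ⟨j, hj⟩ := hcov u x' y' hux' huy'
    obtain ⟨k, hk⟩ := ih x' hux'.lt hx' ((hj j).1 le_rfl).1
    have hy'k : y' ≤ k := ((hj j).1 le_rfl).2.trans ((hk k).1 le_rfl).2
    obtain ⟨m, hm⟩ := ih y' huy'.lt hy'k hy'
    refine ⟨m, fun b => ?_⟩
    rw [hm, hk, hj]
    exact ⟨fun h => ⟨h.1.1, h.2⟩, fun h => ⟨⟨h.1, hx'.trans h.1, hy'.trans h.2⟩, h.2⟩⟩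

theorem exists_isLUB_of_covBy [OrderBot α] [Finite α]
    (hcov : ∀ u x y : α, u ⋖ x → u ⋖ y → ∃ j, IsLUB {x, y} j) (s : Set α) :
    ∃ j, IsLUB s j := by
  induction s, s.toFinite using Set.Finite.induction_on with
  | empty => exact ⟨⊥, isLUB_empty⟩
  | @insert x s _ _ ih =>
    obtain ⟨j, hj⟩ := ih
    obtain ⟨k, hk⟩ := exists_isLUB_pair_of_covBy hcov (bot_le : ⊥ ≤ x) (bot_le : ⊥ ≤ j)
    rw [isLUB_pair_iff] at hk
    refine ⟨k, isLUB_iff_le_iff.2 fun b => ?_⟩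
    rw [hk, isLUB_le_iff hj, upperBounds_insert]
    rfl

end Lattice

/-! ### Generators of a convex cone -/

section Cone

variable {𝕜 M : Type*} [Field 𝕜] [LinearOrder 𝕜] [IsStrictOrderedRing 𝕜] [AddCommGroup M]
  [Module 𝕜 M] {f : M →ₗ[𝕜] 𝕜} {D : Set M} {x y α : M}

theorem apply_nonneg_of_mem_hull (hD : ∀ δ ∈ D, 0 ≤ f δ) (hx : x ∈ PointedCone.hull 𝕜 D) :
    0 ≤ f x := by
  induction hx using Submodule.span_induction with
  | mem x h => exact hD x h
  | zero => simp
  | add x y _ _ hx hy => rw [map_add]; exact add_nonneg hx hy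
  | smul c x _ hx => rw [Nonneg.mk_smul c.1 c.2 x, map_smul]; exact mul_nonneg c.2 hx

theorem mem_hull_of_apply_eq_zero (hD : ∀ δ ∈ D, 0 ≤ f δ) (hx : x ∈ PointedCone.hull 𝕜 D)
    (h0 : f x = 0) : x ∈ PointedCone.hull 𝕜 {δ ∈ D | f δ = 0} := by
  induction hx using Submodule.span_induction with
  | mem x h => exact Submodule.subset_span ⟨h, h0⟩
  | zero => exact zero_mem _
  | add x y hx hy ihx ihy =>
    have hfx := apply_nonneg_of_mem_hull hD hx
    have hfy := apply_nonneg_of_mem_hull hD hy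
    rw [map_add] at h0
    exact add_mem (ihx (by linarith)) (ihy (by linarith))
  | smul c x _ ih =>
    rcases eq_or_ne c 0 with rfl | hc
    · simp
    · rw [Nonneg.mk_smul c.1 c.2 x, map_smul, smul_eq_mul] at h0
      exact Submodule.smul_mem _ _ (ih ((mul_eq_zero.1 h0).resolve_left fun h =>
        hc (Subtype.ext h)))

theorem eq_zero_of_mem_hull (hD : ∀ δ ∈ D, 0 < f δ) (hx : x ∈ PointedCone.hull 𝕜 D)
    (h0 : f x = 0) : x = 0 := by
  have hempty : {δ ∈ D | f δ = 0} = ∅ :=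
    Set.eq_empty_of_forall_notMem fun δ hδ => (hD δ hδ.1).ne' hδ.2
  simpa [hempty] using mem_hull_of_apply_eq_zero (fun δ hδ => (hD δ hδ).le) hx h0

theorem exists_eq_smul_add_of_mem_hull (hα : α ∈ D) (hx : x ∈ PointedCone.hull 𝕜 D) :
    ∃ t : 𝕜, 0 ≤ t ∧ ∃ z ∈ PointedCone.hull 𝕜 (D \ {α}), x = t • α + z := by
  rw [← Set.insert_sdiff_self_of_mem hα] at hx
  obtain ⟨t, z, hz, rfl⟩ := Submodule.mem_span_insert.1 hx
  exact ⟨t, t.2, z, hz, rfl⟩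

theorem exists_eq_smul_of_add_eq_smul (hD : ∀ δ ∈ D, 0 < f δ) (hα : α ∈ D)
    (hα' : α ∉ PointedCone.hull 𝕜 (D \ {α})) (hx : x ∈ PointedCone.hull 𝕜 D)
    (hy : y ∈ PointedCone.hull 𝕜 D) {c : 𝕜} (hxy : x + y = c • α) : ∃ t : 𝕜, x = t • α := by
  obtain ⟨t, -, z, hz, rfl⟩ := exists_eq_smul_add_of_mem_hull hα hx
  obtain ⟨t', -, z', hz', rfl⟩ := exists_eq_smul_add_of_mem_hull hα hy
  have hzz : z + z' = (c - t - t') • α := by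
    rw [sub_smul, sub_smul, ← hxy]
    abel
  have hc : c - t - t' ≤ 0 := by
    by_contra! hc
    refine hα' ?_
    have := PointedCone.smul_mem _ (inv_nonneg.2 hc.le) (add_mem hz hz')
    rwa [hzz, inv_smul_smul₀ hc.ne'] at this
  have hD' : ∀ δ ∈ D \ {α}, 0 < f δ := fun δ hδ => hD δ hδ.1
  have hfz := apply_nonneg_of_mem_hull (fun δ hδ => (hD' δ hδ).le) hz
  have hfz' := apply_nonneg_of_mem_hull (fun δ hδ => (hD' δ hδ).le) hz'
  have hf : f z + f z' = (c - t - t') * f α := by rw [← map_add, hzz, map_smul, smul_eq_mul]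
  have hfz0 : f z = 0 := by nlinarith [mul_nonpos_of_nonpos_of_nonneg hc (hD α hα).le]
  exact ⟨t, by rw [eq_zero_of_mem_hull hD' hz hfz0, add_zero]⟩

end Cone

variable {V : Type*} [NormedAddCommGroup V] [InnerProductSpace ℝ V]

/-! ### Reflections and root systems -/

theorem reflAlong_apply (α x : V) : reflAlong α x = x - (2 * ⟪α, x⟫ / ⟪α, α⟫) • α := by
  rw [reflAlong, Submodule.reflection_orthogonal_apply, Submodule.reflection_singleton_apply,
    real_inner_self_eq_norm_sq, neg_sub, two_nsmul, ← add_smul]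
  congr 2
  simp only [RCLike.ofReal_real_eq_id, id]
  ring

theorem reflAlong_self (α : V) : reflAlong α α = -α :=
  Submodule.reflection_orthogonalComplement_singleton_eq_neg α

theorem reflAlong_reflAlong (α x : V) : reflAlong α (reflAlong α x) = x :=
  Submodule.reflection_reflection _ x

theorem reflAlong_mul_self (α : V) : reflAlong α * reflAlong α = 1 :=
  LinearIsometryEquiv.ext (reflAlong_reflAlong α)

theorem inner_reflAlong (α x y : V) : ⟪reflAlong α x, y⟫ = ⟪x, reflAlong α y⟫ := by
  conv_rhs => rw [← LinearIsometryEquiv.inner_map_map (reflAlong α), reflAlong_reflAlong]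

theorem reflAlong_map (g : V ≃ₗᵢ[ℝ] V) (α : V) : reflAlong (g α) * g = g * reflAlong α := by
  ext x
  simp [LinearIsometryEquiv.coe_mul, reflAlong_apply]

theorem reflAlong_neg (α : V) : reflAlong (-α) = reflAlong α := by
  ext x
  simp [reflAlong_apply, neg_div]

variable {W : Subgroup (V ≃ₗᵢ[ℝ] V)} {Φ Δ : Set V} {a : V}

theorem apply_inv_apply (w : W) (x : V) : w.1 (w⁻¹.1 x) = x :=
  w.1.apply_symm_apply x

theorem inner_apply_left (w : W) (x y : V) : ⟪w.1 x, y⟫ = ⟪x, w⁻¹.1 y⟫ := by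
  rw [← LinearIsometryEquiv.inner_map_map w.1 x, apply_inv_apply]

theorem coe_mul_apply (u v : W) (x : V) : (u * v).1 x = u.1 (v.1 x) := rfl

theorem mul_self_of_eq_reflAlong {s : W} {α : V} (hs : s.1 = reflAlong α) : s * s = 1 :=
  Subtype.ext <| by rw [Subgroup.coe_mul, hs, reflAlong_mul_self, Subgroup.coe_one]

namespace IsRootSystem

theorem reflAlong_mem (h : IsRootSystem W Φ) {α : V} (hα : α ∈ Φ) : reflAlong α ∈ W :=
  h.closure_eq.le (Subgroup.subset_closure (Set.mem_image_of_mem _ hα))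

theorem map_mem (h : IsRootSystem W Φ) (w : W) {α : V} (hα : α ∈ Φ) : w.1 α ∈ Φ :=
  h.stable _ w.2 α hα

theorem reflAlong_apply_mem (h : IsRootSystem W Φ) {α β : V} (hα : α ∈ Φ) (hβ : β ∈ Φ) :
    reflAlong α β ∈ Φ :=
  h.stable _ (h.reflAlong_mem hα) β hβ

theorem neg_mem (h : IsRootSystem W Φ) {α : V} (hα : α ∈ Φ) : -α ∈ Φ :=
  reflAlong_self α ▸ h.reflAlong_apply_mem hα hα

theorem smul_eq_or_eq_neg (h : IsRootSystem W Φ) {α : V} (hα : α ∈ Φ) {c : ℝ} (hc : c • α ∈ Φ) :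
    c • α = α ∨ c • α = -α :=
  (h.line_inter α hα).le ⟨Submodule.smul_mem _ _ (Submodule.mem_span_singleton_self α), hc⟩

theorem inner_ne_zero_of_isGeneric (h : IsRootSystem W Φ) (ha : IsGeneric W a) {α : V}
    (hα : α ∈ Φ) : ⟪a, α⟫ ≠ 0 := fun h0 => by
  refine ha _ (h.reflAlong_mem hα) ⟨α, h.ne_zero α hα, rfl⟩ ?_
  simp [reflAlong_apply, real_inner_comm, h0]

end IsRootSystem

/-! ### Separating roots -/

/-- The roots that are positive at `x` and negative at `y`: up to sign, the roots whose hyperplane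
separates `x` from `y`. -/
def separatingRoots (Φ : Set V) (x y : V) : Set V :=
  {β ∈ Φ | 0 < ⟪x, β⟫ ∧ ⟪y, β⟫ < 0}

/-- The inversion set of `w`, relative to the chamber of `a`. -/
def inversions (Φ : Set V) (a : V) (w : W) : Set V :=
  separatingRoots Φ a (w.1 a)

theorem inversions_one : inversions Φ a (1 : W) = ∅ :=
  Set.eq_empty_of_forall_notMem fun _ hβ => lt_asymm hβ.2.1 hβ.2.2

theorem image_separatingRoots (h : IsRootSystem W Φ) (w : W) (x y : V) :
    w.1 '' separatingRoots Φ x y = separatingRoots Φ (w.1 x) (w.1 y) := by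
  ext γ
  constructor
  · rintro ⟨β, ⟨hβ, hx, hy⟩, rfl⟩
    exact ⟨h.map_mem w hβ, by simpa using hx, by simpa using hy⟩
  · rintro ⟨hγ, hx, hy⟩
    rw [inner_apply_left] at hx hy
    exact ⟨w⁻¹.1 γ, ⟨h.map_mem _ hγ, hx, hy⟩, apply_inv_apply w γ⟩

theorem separatingRoots_eq_union (hneg : ∀ β ∈ Φ, -β ∈ Φ) {x y z : V} (hx : ∀ β ∈ Φ, ⟪x, β⟫ ≠ 0)
    (hy : ∀ β ∈ Φ, ⟪y, β⟫ ≠ 0) (hz : ∀ β ∈ Φ, ⟪z, β⟫ ≠ 0) :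
    separatingRoots Φ y z = (separatingRoots Φ x z \ separatingRoots Φ x y) ∪
      Neg.neg '' (separatingRoots Φ x y \ separatingRoots Φ x z) := by
  ext γ
  rw [Set.image_neg_eq_neg]
  simp only [separatingRoots, Set.mem_union, Set.mem_sdiff, Set.mem_neg, Set.mem_ofPred_eq,
    inner_neg_right, neg_pos, Left.neg_neg_iff]
  have hmem : -γ ∈ Φ ↔ γ ∈ Φ := ⟨fun hγ => neg_neg γ ▸ hneg _ hγ, hneg γ⟩
  rw [hmem]
  by_cases hγ : γ ∈ Φ
  · have := hx γ hγ
    have := hy γ hγ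
    have := hz γ hγ
    grind
  · simp [hγ]

theorem ncard_separatingRoots (hΦ : Φ.Finite) (hneg : ∀ β ∈ Φ, -β ∈ Φ) {x y z : V}
    (hx : ∀ β ∈ Φ, ⟪x, β⟫ ≠ 0) (hy : ∀ β ∈ Φ, ⟪y, β⟫ ≠ 0) (hz : ∀ β ∈ Φ, ⟪z, β⟫ ≠ 0) :
    (separatingRoots Φ y z).ncard = (separatingRoots Φ x z \ separatingRoots Φ x y).ncard +
      (separatingRoots Φ x y \ separatingRoots Φ x z).ncard := by
  have hfin : ∀ z, (separatingRoots Φ x z).Finite := fun z => hΦ.subset fun _ hβ => hβ.1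
  rw [separatingRoots_eq_union hneg hx hy hz, Set.ncard_union_eq ?_ (hfin z).sdiff
    ((hfin y).sdiff.image _), Set.ncard_image_of_injective _ neg_injective]
  rw [Set.disjoint_left]
  rintro _ hβ ⟨γ, hγ, rfl⟩
  have hβpos := hβ.1.2.1
  rw [inner_neg_right, neg_pos] at hβpos
  exact hβpos.not_gt hγ.1.2.1

/-! ### Simple roots -/

/-- `Δ` is the set of simple roots of the root system `Φ` of `W` that is positive at the regular
point `a`. Minimality of `Δ` is recorded in the form that no simple root lies in the convex cone
generated by the other ones. -/
structure IsBase (W : Subgroup (V ≃ₗᵢ[ℝ] V)) (Φ : Set V) (a : V) (Δ : Set V) : Prop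
    extends IsRootSystem W Φ where
  regular : ∀ α ∈ Φ, ⟪a, α⟫ ≠ 0
  subset : Δ ⊆ Φ
  pos : ∀ α ∈ Δ, 0 < ⟪a, α⟫
  mem_hull : ∀ β ∈ Φ, 0 < ⟪a, β⟫ → β ∈ PointedCone.hull ℝ Δ
  notMem_hull : ∀ α ∈ Δ, α ∉ PointedCone.hull ℝ (Δ \ {α})

theorem IsRootSystem.isBase (hΦ : IsRootSystem W Φ) (ha : IsGeneric W a)
    (hΔ : IsSimpleSystem Φ Δ) (haΔ : ∀ α ∈ Δ, 0 < ⟪a, α⟫) : IsBase W Φ a Δ := by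
  obtain ⟨P, ⟨f, hf, rfl⟩, ⟨hsub, hhull⟩, hmin⟩ := hΔ
  refine ⟨hΦ, fun α hα => hΦ.inner_ne_zero_of_isGeneric ha hα, fun α hα => (hsub hα).1, haΔ,
    fun β hβ hpos => ?_, fun α hα hmem => ?_⟩
  · rw [hhull]
    refine PointedCone.subset_hull ⟨hβ, (hf β hβ).lt_or_gt.resolve_left fun hlt => ?_⟩
    have hmem : -β ∈ PointedCone.hull ℝ Δ :=
      hhull ▸ PointedCone.subset_hull ⟨hΦ.neg_mem hβ, by simpa using hlt⟩
    have := apply_nonneg_of_mem_hull (f := innerₗ V a) (fun δ hδ => (haΔ δ hδ).le) hmem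
    rw [innerₗ_apply_apply, inner_neg_right] at this
    linarith
  · have hle : PointedCone.hull ℝ (Δ \ {α}) = PointedCone.hull ℝ Δ := by
      refine le_antisymm (Submodule.span_mono Set.sdiff_subset) (Submodule.span_le.2 fun δ hδ => ?_)
      by_cases h : δ = α
      · exact h ▸ hmem
      · exact Submodule.subset_span ⟨hδ, h⟩
    exact (hmin ⟨Set.sdiff_subset.trans hsub, hle.trans hhull⟩ Set.sdiff_subset hα).2 rfl

namespace IsBase

theorem apply_nonneg (h : IsBase W Φ a Δ) {f : V →ₗ[ℝ] ℝ} (hf : ∀ δ ∈ Δ, 0 ≤ f δ) {β : V}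
    (hβ : β ∈ Φ) (hpos : 0 < ⟪a, β⟫) : 0 ≤ f β :=
  apply_nonneg_of_mem_hull hf (h.mem_hull β hβ hpos)

theorem apply_regular (h : IsBase W Φ a Δ) (w : W) {β : V} (hβ : β ∈ Φ) : ⟪w.1 a, β⟫ ≠ 0 := by
  rw [inner_apply_left]
  exact h.regular _ (h.map_mem _ hβ)

theorem exists_eq_smul (h : IsBase W Φ a Δ) {α x y : V} (hα : α ∈ Δ)
    (hx : x ∈ PointedCone.hull ℝ Δ) (hy : y ∈ PointedCone.hull ℝ Δ) {c : ℝ} (hxy : x + y = c • α) :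
    ∃ t : ℝ, x = t • α :=
  exists_eq_smul_of_add_eq_smul (f := innerₗ V a) h.pos hα (h.notMem_hull α hα) hx hy hxy

theorem eq_of_smul_mem (h : IsBase W Φ a Δ) {α : V} {t : ℝ} (hα : α ∈ Δ) (ht : t • α ∈ Φ)
    (hpos : 0 < ⟪a, t • α⟫) : t • α = α := by
  refine (h.smul_eq_or_eq_neg (h.subset hα) ht).resolve_right fun hneg => ?_
  rw [hneg, inner_neg_right] at hpos
  linarith [h.pos α hα]

theorem inner_reflAlong_pos (h : IsBase W Φ a Δ) {α β : V} (hα : α ∈ Δ) (hβ : β ∈ Φ)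
    (hpos : 0 < ⟪a, β⟫) (hne : β ≠ α) : 0 < ⟪a, reflAlong α β⟫ := by
  have hr := h.reflAlong_apply_mem (h.subset hα) hβ
  refine (h.regular _ hr).lt_or_gt.resolve_left fun hlt => hne ?_
  have hmem : -reflAlong α β ∈ PointedCone.hull ℝ Δ :=
    h.mem_hull _ (h.neg_mem hr) (by rwa [inner_neg_right, neg_pos])
  obtain ⟨t, rfl⟩ := h.exists_eq_smul hα (h.mem_hull β hβ hpos) hmem
    (c := 2 * ⟪α, β⟫ / ⟪α, α⟫) (by rw [reflAlong_apply]; abel)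
  exact h.eq_of_smul_mem hα hβ hpos

theorem inner_reflAlong_pos_iff (h : IsBase W Φ a Δ) {α β : V} (hα : α ∈ Δ) (hβ : β ∈ Φ)
    (hne : β ≠ α) (hne' : β ≠ -α) : 0 < ⟪a, reflAlong α β⟫ ↔ 0 < ⟪a, β⟫ := by
  refine ⟨fun hpos => ?_, fun hpos => h.inner_reflAlong_pos hα hβ hpos hne⟩
  rw [← reflAlong_reflAlong α β]
  refine h.inner_reflAlong_pos hα (h.reflAlong_apply_mem (h.subset hα) hβ) hpos fun heq => hne' ?_
  rw [← reflAlong_reflAlong α β, heq, reflAlong_self]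

theorem inner_nonpos (h : IsBase W Φ a Δ) {α β : V} (hα : α ∈ Δ) (hβ : β ∈ Δ) (hne : α ≠ β) :
    ⟪α, β⟫ ≤ 0 := by
  by_contra! hpos
  have hαα := real_inner_self_pos.2 (h.ne_zero α (h.subset hα))
  set c := 2 * ⟪α, β⟫ / ⟪α, α⟫
  have hc0 : 0 < c := by positivity
  have hr : reflAlong α β ∈ PointedCone.hull ℝ Δ :=
    h.mem_hull _ (h.reflAlong_apply_mem (h.subset hα) (h.subset hβ))
      (h.inner_reflAlong_pos hα (h.subset hβ) (h.pos β hβ) hne.symm)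
  obtain ⟨t, ht⟩ := h.exists_eq_smul hβ
    (PointedCone.smul_mem _ hc0.le (PointedCone.subset_hull hα)) hr (c := 1)
    (by rw [reflAlong_apply, one_smul]; abel)
  have hα' : α = (c⁻¹ * t) • β := by rw [mul_smul, ← ht, inv_smul_smul₀ hc0.ne']
  refine hne (hα'.trans (h.eq_of_smul_mem hβ ?_ ?_)) <;> rw [← hα']
  exacts [h.subset hα, h.pos α hα]

theorem linearIndepOn (h : IsBase W Φ a Δ) : LinearIndepOn ℝ id Δ := by
  refine LinearMap.BilinForm.linearIndependent_of_pairwise_le_zero (innerₗ V) (fun x hx => ?_)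
    (innerₗ V a) _ (fun δ => h.pos δ δ.2)
    fun α β hne => h.inner_nonpos α.2 β.2 (Subtype.coe_ne_coe.2 hne)
  exact real_inner_self_pos.2 hx

theorem exists_simple (h : IsBase W Φ a Δ) {α : V} (hα : α ∈ Δ) :
    ∃ s ∈ simpleReflections W Δ, s.1 = reflAlong α :=
  ⟨⟨_, h.reflAlong_mem (h.subset hα)⟩, ⟨α, hα, rfl⟩, rfl⟩

end IsBase

/-! ### Length and inversions -/

namespace IsBase

theorem apply_mul_simple (h : IsBase W Φ a Δ) (w : W) {s : W} {α : V} (hα : α ∈ Δ)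
    (hs : s.1 = reflAlong α) : ∃ k : ℝ, 0 < k ∧ (w * s).1 a = w.1 a - k • w.1 α := by
  have hαα := real_inner_self_pos.2 (h.ne_zero α (h.subset hα))
  have haα := h.pos α hα
  rw [real_inner_comm] at haα
  refine ⟨2 * ⟪α, a⟫ / ⟪α, α⟫, by positivity, ?_⟩
  rw [coe_mul_apply, hs, reflAlong_apply, map_sub, map_smul]

theorem mul_simple_ne (h : IsBase W Φ a Δ) (w : W) {s : W} {α : V} (hα : α ∈ Δ)
    (hs : s.1 = reflAlong α) : w * s ≠ w := fun heq => by
  obtain ⟨k, hk, hws⟩ := h.apply_mul_simple w hα hs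
  rw [heq, eq_comm, sub_eq_self] at hws
  exact (smul_ne_zero hk.ne' (h.ne_zero _ (h.map_mem w (h.subset hα)))) hws

theorem inversions_mul (h : IsBase W Φ a Δ) {w s : W} {α : V} (hα : α ∈ Δ)
    (hs : s.1 = reflAlong α) (hw : 0 < ⟪a, w.1 α⟫) :
    inversions Φ a (w * s) = insert (w.1 α) (inversions Φ a w) := by
  have hα0 := h.pos α hα
  have hwα := h.map_mem w (h.subset hα)
  ext β
  simp only [inversions, separatingRoots, Set.mem_ofPred_eq, Set.mem_insert_iff]
  rw [coe_mul_apply, inner_apply_left w, inner_apply_left w, hs, inner_reflAlong]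
  by_cases h1 : w⁻¹.1 β = α
  · have hβ : β = w.1 α := by rw [← h1, apply_inv_apply]
    simp [hβ, reflAlong_self, hw, hα0, hwα]
  by_cases h2 : w⁻¹.1 β = -α
  · have hβ : β = -w.1 α := by rw [← map_neg, ← h2, apply_inv_apply]
    have hβ0 : ¬0 < ⟪a, β⟫ := by rw [hβ, inner_neg_right, neg_pos]; exact hw.not_gt
    have hne : β ≠ w.1 α := by rintro rfl; exact hβ0 hw
    simp [hβ0, hne]
  have hne : β ≠ w.1 α := by
    rintro rfl
    exact h1 (w.1.symm_apply_apply α)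
  simp only [hne, false_or]
  refine and_congr_right fun hβ => and_congr_right fun _ => ?_
  have hβ' := h.map_mem w⁻¹ hβ
  have hsign : ∀ γ ∈ Φ, ⟪a, γ⟫ < 0 ↔ ¬0 < ⟪a, γ⟫ := fun γ hγ =>
    ⟨fun hlt => hlt.not_gt, (h.regular γ hγ).lt_or_gt.resolve_right⟩
  rw [hsign _ hβ', hsign _ (h.reflAlong_apply_mem (h.subset hα) hβ'),
    h.inner_reflAlong_pos_iff hα hβ' h1 h2]

theorem finite_inversions (h : IsBase W Φ a Δ) (w : W) : (inversions Φ a w).Finite :=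
  h.finite.subset fun _ hβ => hβ.1

theorem ncard_inversions_mul (h : IsBase W Φ a Δ) {w s : W} {α : V} (hα : α ∈ Δ)
    (hs : s.1 = reflAlong α) (hw : 0 < ⟪a, w.1 α⟫) :
    (inversions Φ a (w * s)).ncard = (inversions Φ a w).ncard + 1 := by
  have hnotMem : w.1 α ∉ inversions Φ a w := fun hmem => by
    have hneg := hmem.2.2
    rw [LinearIsometryEquiv.inner_map_map] at hneg
    exact hneg.not_gt (h.pos α hα)
  rw [h.inversions_mul hα hs hw, Set.ncard_insert_of_notMem hnotMem (h.finite_inversions w)]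

/-- A root that is positive but not simple makes an acute angle with some simple root `δ`, and
`s_δ` turns it into a positive root that is lower with respect to `⟪a, ·⟫`. -/
theorem reflAlong_mem_closure (h : IsBase W Φ a Δ) {β : V} (hβ : β ∈ Φ) :
    reflAlong β ∈ Subgroup.closure (reflAlong '' Δ) := by
  suffices hpos : ∀ β ∈ Φ, 0 < ⟪a, β⟫ → reflAlong β ∈ Subgroup.closure (reflAlong '' Δ) by
    rcases (h.regular β hβ).lt_or_gt with h0 | h0
    · rw [← reflAlong_neg]
      exact hpos _ (h.neg_mem hβ) (by rwa [inner_neg_right, neg_pos])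
    · exact hpos β hβ h0
  by_contra! hcon
  obtain ⟨γ, ⟨hγ, hpos, hbad⟩, hmin⟩ := Set.exists_min_image
    {β | β ∈ Φ ∧ 0 < ⟪a, β⟫ ∧ reflAlong β ∉ Subgroup.closure (reflAlong '' Δ)} (fun β => ⟪a, β⟫)
    (h.finite.subset fun _ hβ => hβ.1) hcon
  obtain ⟨δ, hδ, hγδ⟩ : ∃ δ ∈ Δ, 0 < ⟪δ, γ⟫ := by
    by_contra! hneg
    have := h.apply_nonneg (f := -innerₗ V γ) (fun δ hδ => by
      simpa [real_inner_comm] using hneg δ hδ) hγ hpos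
    rw [LinearMap.neg_apply, innerₗ_apply_apply] at this
    linarith [real_inner_self_pos.2 (h.ne_zero γ hγ)]
  have hδmem : reflAlong δ ∈ Subgroup.closure (reflAlong '' Δ) :=
    Subgroup.subset_closure (Set.mem_image_of_mem _ hδ)
  have hlt : ⟪a, reflAlong δ γ⟫ < ⟪a, γ⟫ := by
    rw [reflAlong_apply, inner_sub_right, inner_smul_right, sub_lt_self_iff]
    have hδδ := real_inner_self_pos.2 (h.ne_zero δ (h.subset hδ))
    have haδ := h.pos δ hδ
    positivity
  have hgood : reflAlong (reflAlong δ γ) ∈ Subgroup.closure (reflAlong '' Δ) := by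
    by_contra hbad'
    refine hlt.not_ge (hmin _ ⟨h.reflAlong_apply_mem (h.subset hδ) hγ,
      h.inner_reflAlong_pos hδ hγ hpos ?_, hbad'⟩)
    rintro rfl
    exact hbad hδmem
  refine hbad ?_
  have := mul_mem (mul_mem hδmem hgood) hδmem
  rwa [mul_assoc, reflAlong_map, ← mul_assoc, reflAlong_mul_self, one_mul] at this

theorem closure_simpleReflections (h : IsBase W Φ a Δ) :
    Submonoid.closure (simpleReflections W Δ) = ⊤ := by
  have himage : W.subtype '' simpleReflections W Δ = reflAlong '' Δ := by
    ext g
    constructor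
    · rintro ⟨s, ⟨α, hα, hs⟩, rfl⟩
      exact ⟨α, hα, hs.symm⟩
    · rintro ⟨α, hα, rfl⟩
      obtain ⟨s, hs, hsα⟩ := h.exists_simple hα
      exact ⟨s, hs, hsα⟩
  have hgroup : Subgroup.closure (simpleReflections W Δ) = ⊤ := by
    refine Subgroup.map_injective W.subtype_injective ?_
    rw [MonoidHom.map_closure, himage, ← MonoidHom.range_eq_map, Subgroup.range_subtype]
    refine le_antisymm ((Subgroup.closure_le _).2 ?_) (h.closure_eq.ge.trans
      ((Subgroup.closure_le _).2 ?_))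
    · rintro _ ⟨α, hα, rfl⟩
      exact h.reflAlong_mem (h.subset hα)
    · rintro _ ⟨β, hβ, rfl⟩
      exact h.reflAlong_mem_closure hβ
  have hinv : (simpleReflections W Δ)⁻¹ ⊆ simpleReflections W Δ := by
    rintro s ⟨α, hα, hs⟩
    have hss : s⁻¹⁻¹ = s⁻¹ := inv_eq_of_mul_eq_one_right (mul_self_of_eq_reflAlong hs)
    exact ⟨α, hα, by rw [← hs, ← hss, inv_inv]⟩
  rw [← Set.union_eq_self_of_subset_right hinv, ← Subgroup.closure_toSubmonoid, hgroup,
    Subgroup.top_toSubmonoid]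

/-- The exchange condition: only the simple root `α` becomes negative under `s_α`. -/
theorem length_mul_lt (h : IsBase W Φ a Δ) {w s : W} {α : V} (hα : α ∈ Δ)
    (hs : s.1 = reflAlong α) (hw : ⟪a, w.1 α⟫ < 0) :
    length (simpleReflections W Δ) (w * s) < length (simpleReflections W Δ) w := by
  induction w using length_induction_left h.closure_simpleReflections with
  | one => exact absurd (h.pos α hα) hw.not_gt
  | mul t ht x hlen ih =>
    have hxα := h.map_mem x (h.subset hα)
    rw [hlen]
    rcases (h.regular _ hxα).lt_or_gt with hneg | hpos
    · have htle := length_mul_le h.closure_simpleReflections t (x * s)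
      have ht1 := length_le_one ht
      have := ih hneg
      rw [mul_assoc]
      lia
    · obtain ⟨δ, hδ, htδ⟩ := ht
      have heq : x.1 α = δ := by
        by_contra hne
        rw [coe_mul_apply, htδ] at hw
        exact hw.not_gt (h.inner_reflAlong_pos hδ hxα hpos hne)
      have hcomm : t * x = x * s := Subtype.ext <| by
        rw [Subgroup.coe_mul, Subgroup.coe_mul, htδ, hs, ← heq, reflAlong_map]
      rw [hcomm, mul_assoc, mul_self_of_eq_reflAlong hs, mul_one]
      exact Nat.lt_succ_self _

theorem inner_pos_of_length_lt (h : IsBase W Φ a Δ) {w s : W} {α : V} (hα : α ∈ Δ)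
    (hs : s.1 = reflAlong α)
    (hlt : length (simpleReflections W Δ) w < length (simpleReflections W Δ) (w * s)) :
    0 < ⟪a, w.1 α⟫ :=
  (h.regular _ (h.map_mem w (h.subset hα))).lt_or_gt.resolve_left fun hneg =>
    hlt.not_gt (h.length_mul_lt hα hs hneg)

theorem length_eq_ncard_inversions (h : IsBase W Φ a Δ) (w : W) :
    length (simpleReflections W Δ) w = (inversions Φ a w).ncard := by
  induction w using length_induction_right h.closure_simpleReflections with
  | one => rw [length_one, inversions_one, Set.ncard_empty]
  | mul x s hs hlen ih =>
    obtain ⟨α, hα, hs⟩ := hs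
    have hpos := h.inner_pos_of_length_lt (w := x) hα hs (by lia)
    rw [hlen, ih, h.ncard_inversions_mul hα hs hpos]

theorem ncard_separatingRoots (h : IsBase W Φ a Δ) (u v : W) :
    (separatingRoots Φ (u.1 a) (v.1 a)).ncard = length (simpleReflections W Δ) (u⁻¹ * v) := by
  rw [h.length_eq_ncard_inversions, inversions,
    ← Set.ncard_image_of_injective (separatingRoots Φ a _) u.1.injective,
    image_separatingRoots h.toIsRootSystem, coe_mul_apply, apply_inv_apply]

theorem eq_of_separatingRoots_eq_empty (h : IsBase W Φ a Δ) {u v : W}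
    (huv : separatingRoots Φ (u.1 a) (v.1 a) = ∅) : u = v := by
  rw [← inv_mul_eq_one, ← length_eq_zero h.closure_simpleReflections, ← h.ncard_separatingRoots,
    huv, Set.ncard_empty]

theorem length_inv_mul (h : IsBase W Φ a Δ) (u v : W) :
    length (simpleReflections W Δ) (u⁻¹ * v) = (inversions Φ a v \ inversions Φ a u).ncard +
      (inversions Φ a u \ inversions Φ a v).ncard := by
  rw [← h.ncard_separatingRoots]
  exact CoxeterPerm.ncard_separatingRoots h.finite (fun _ => h.neg_mem) h.regular
    (fun _ => h.apply_regular u) fun _ => h.apply_regular v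

theorem inversions_injective (h : IsBase W Φ a Δ) :
    Function.Injective (inversions Φ a : W → Set V) := fun u v huv => by
  have hlen := h.length_inv_mul u v
  rw [huv, Set.sdiff_self, Set.ncard_empty, length_eq_zero h.closure_simpleReflections] at hlen
  exact inv_mul_eq_one.1 hlen

theorem finite_group (h : IsBase W Φ a Δ) : Finite W :=
  have := h.finite.powerset.to_subtype
  Finite.of_injective (fun w : W => (⟨inversions Φ a w, fun _ hβ => hβ.1⟩ : 𝒫 Φ))
    fun _ _ huv => h.inversions_injective (congrArg Subtype.val huv)

theorem rightWeakLE_iff (h : IsBase W Φ a Δ) {u v : W} :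
    RightWeakLE (simpleReflections W Δ) u v ↔ inversions Φ a u ⊆ inversions Φ a v := by
  rw [CoxeterPerm.rightWeakLE_iff, h.length_inv_mul, h.length_eq_ncard_inversions,
    h.length_eq_ncard_inversions, ← Set.sdiff_eq_empty,
    ← Set.ncard_eq_zero (h.finite_inversions u).sdiff]
  have hu := Set.ncard_inter_add_ncard_sdiff_eq_ncard (inversions Φ a u) (inversions Φ a v)
    (h.finite_inversions u)
  have hv := Set.ncard_inter_add_ncard_sdiff_eq_ncard (inversions Φ a v) (inversions Φ a u)
    (h.finite_inversions v)
  rw [Set.inter_comm] at hv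
  lia

end IsBase

/-! ### Maximizers of a linear functional on the orbit -/

/-- The elements `w` for which `w a` lies on the face of the permutahedron in direction `f`. -/
def maximizers (W : Subgroup (V ≃ₗᵢ[ℝ] V)) (a : V) (f : V →ₗ[ℝ] ℝ) : Set W :=
  {w | ∀ w' : W, f (w'.1 a) ≤ f (w.1 a)}

open Filter Topology in
theorem exists_pos_forall_add_smul_pos {ι : Type*} {s : Set ι} (hs : s.Finite) (p q : ι → ℝ) :
    ∃ ε : ℝ, 0 < ε ∧ ∀ i ∈ s, 0 < p i → 0 < p i + ε * q i := by
  have hev : ∀ᶠ ε in 𝓝[>] (0 : ℝ), ∀ i ∈ s, 0 < p i → 0 < p i + ε * q i := by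
    refine Eventually.filter_mono nhdsWithin_le_nhds ?_
    rw [eventually_all_finite hs]
    intro i _
    rw [eventually_imp_distrib_left]
    intro hi
    have hcont : ContinuousAt (fun ε : ℝ => p i + ε * q i) 0 := by fun_prop
    exact hcont.eventually_const_lt (by simpa using hi)
  exact (eventually_mem_nhdsWithin.and hev).exists

namespace IsBase

theorem sub_apply_mem_hull (h : IsBase W Φ a Δ) (w : W) :
    a - w.1 a ∈ PointedCone.hull ℝ Δ := by
  induction w using length_induction_right h.closure_simpleReflections with
  | one =>
    change a - a ∈ _
    rw [sub_self]
    exact zero_mem _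
  | mul x s hs hlen ih =>
    obtain ⟨α, hα, hs⟩ := hs
    obtain ⟨k, hk, hxs⟩ := h.apply_mul_simple x hα hs
    have hxα := h.mem_hull _ (h.map_mem x (h.subset hα))
      (h.inner_pos_of_length_lt (w := x) hα hs (by lia))
    rw [hxs, ← sub_add]
    exact add_mem ih (PointedCone.smul_mem _ hk.le hxα)

theorem mem_maximizers_iff (h : IsBase W Φ a Δ) {f : V →ₗ[ℝ] ℝ} {w : W} :
    w ∈ maximizers W a f ↔ ∀ δ ∈ Δ, 0 ≤ f (w.1 δ) := by
  constructor
  · intro hw δ hδ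
    obtain ⟨s, -, hs⟩ := h.exists_simple hδ
    obtain ⟨k, hk, hws⟩ := h.apply_mul_simple w hδ hs
    have hle := hw (w * s)
    rw [hws, map_sub, map_smul, smul_eq_mul, sub_le_self_iff] at hle
    exact nonneg_of_mul_nonneg_right hle hk
  · intro hf w'
    have hle := apply_nonneg_of_mem_hull (f := f ∘ₗ w.1.toLinearMap) hf
      (h.sub_apply_mem_hull (w⁻¹ * w'))
    rw [map_sub, sub_nonneg] at hle
    simpa [coe_mul_apply] using hle

theorem mem_maximizers_iff_inner (h : IsBase W Φ a Δ) {f : V →ₗ[ℝ] ℝ} {w : W} :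
    w ∈ maximizers W a f ↔ ∀ β ∈ Φ, 0 < f β → 0 < ⟪w.1 a, β⟫ := by
  rw [h.mem_maximizers_iff]
  constructor
  · intro hf β hβ hpos
    refine (h.apply_regular w hβ).lt_or_gt.resolve_left fun hneg => ?_
    rw [inner_apply_left, ← neg_pos, ← inner_neg_right] at hneg
    have hle := h.apply_nonneg (f := f ∘ₗ w.1.toLinearMap) hf (h.neg_mem (h.map_mem _ hβ)) hneg
    have hle' : 0 ≤ -f (w.1 (w⁻¹.1 β)) := by simpa using hle
    rw [apply_inv_apply] at hle'
    linarith
  · intro hf δ hδ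
    by_contra! hlt
    have hneg := hf _ (h.neg_mem (h.map_mem w (h.subset hδ))) (by rwa [map_neg, neg_pos])
    rw [inner_neg_right, neg_pos, LinearIsometryEquiv.inner_map_map] at hneg
    exact hneg.not_gt (h.pos δ hδ)

theorem mem_maximizers_iff_inversions (h : IsBase W Φ a Δ) {f : V →ₗ[ℝ] ℝ} {w : W} :
    w ∈ maximizers W a f ↔ {β ∈ Φ | 0 < ⟪a, β⟫ ∧ f β < 0} ⊆ inversions Φ a w ∧
      inversions Φ a w ⊆ {β ∈ Φ | 0 < ⟪a, β⟫ ∧ f β ≤ 0} := by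
  rw [h.mem_maximizers_iff_inner]
  constructor
  · refine fun hw => ⟨fun β ⟨hβ, hpos, hneg⟩ => ⟨hβ, hpos, ?_⟩, fun β ⟨hβ, hpos, hneg⟩ =>
      ⟨hβ, hpos, ?_⟩⟩
    · have := hw _ (h.neg_mem hβ) (by rwa [map_neg, neg_pos])
      rwa [inner_neg_right, neg_pos] at this
    · exact le_of_not_gt fun hfβ => hneg.not_gt (hw β hβ hfβ)
  · rintro ⟨hsub, hsub'⟩ β hβ hfβ
    rcases (h.regular β hβ).lt_or_gt with hneg | hpos
    · have := (hsub ⟨h.neg_mem hβ, by rwa [inner_neg_right, neg_pos],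
        by rwa [map_neg, neg_lt_zero]⟩).2.2
      rwa [inner_neg_right, neg_lt_zero] at this
    · exact (h.apply_regular w hβ).lt_or_gt.resolve_left fun hlt =>
        hfβ.not_ge (hsub' ⟨hβ, hpos, hlt⟩).2.2

theorem exists_forall_inner_pos (h : IsBase W Φ a Δ) (f g : V →ₗ[ℝ] ℝ) :
    ∃ w : W, ∀ β ∈ Φ, (0 < f β ∨ f β = 0 ∧ 0 < g β) → 0 < ⟪w.1 a, β⟫ := by
  have := h.finite_group
  obtain ⟨ε, hε, hfg⟩ := exists_pos_forall_add_smul_pos h.finite f g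
  obtain ⟨w, hw⟩ : (maximizers W a (f + ε • g)).Nonempty :=
    Finite.exists_max fun w : W => (f + ε • g) (w.1 a)
  refine ⟨w, fun β hβ hpos => h.mem_maximizers_iff_inner.1 hw β hβ ?_⟩
  rw [LinearMap.add_apply, LinearMap.smul_apply, smul_eq_mul]
  rcases hpos with hf | ⟨hf, hg⟩
  · exact hfg β hβ hf
  · rw [hf, zero_add]
    exact mul_pos hε hg

theorem exists_inversions_eq_lt (h : IsBase W Φ a Δ) (f : V →ₗ[ℝ] ℝ) :
    ∃ u : W, inversions Φ a u = {β ∈ Φ | 0 < ⟪a, β⟫ ∧ f β < 0} := by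
  obtain ⟨u, hu⟩ := h.exists_forall_inner_pos f (innerₗ V a)
  refine ⟨u, Set.ext fun β => and_congr_right fun hβ => and_congr_right fun hpos => ?_⟩
  constructor
  · intro hlt
    by_contra! hle
    exact hlt.not_gt (hu β hβ (hle.lt_or_eq'.imp_right fun h0 => ⟨h0, hpos⟩))
  · intro hlt
    have := hu _ (h.neg_mem hβ) (Or.inl (by rwa [map_neg, neg_pos]))
    rwa [inner_neg_right, neg_pos] at this

theorem exists_inversions_eq_le (h : IsBase W Φ a Δ) (f : V →ₗ[ℝ] ℝ) :
    ∃ v : W, inversions Φ a v = {β ∈ Φ | 0 < ⟪a, β⟫ ∧ f β ≤ 0} := by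
  obtain ⟨v, hv⟩ := h.exists_forall_inner_pos f (-innerₗ V a)
  refine ⟨v, Set.ext fun β => and_congr_right fun hβ => and_congr_right fun hpos => ?_⟩
  refine ⟨fun hlt => le_of_not_gt fun hf => hlt.not_gt (hv β hβ (Or.inl hf)), fun hle => ?_⟩
  have := hv _ (h.neg_mem hβ) (hle.lt_or_eq.imp (by simp) fun h0 => ⟨by simp [h0], by simpa⟩)
  rwa [inner_neg_right, neg_pos] at this

theorem exists_maximizers_eq (h : IsBase W Φ a Δ) (f : V →ₗ[ℝ] ℝ) :
    ∃ u v : W, inversions Φ a u ⊆ inversions Φ a v ∧ maximizers W a f =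
      {w | inversions Φ a u ⊆ inversions Φ a w ∧ inversions Φ a w ⊆ inversions Φ a v} := by
  obtain ⟨u, hu⟩ := h.exists_inversions_eq_lt f
  obtain ⟨v, hv⟩ := h.exists_inversions_eq_le f
  refine ⟨u, v, ?_, Set.ext fun w => ?_⟩
  · rw [hu, hv]
    exact fun β hβ => ⟨hβ.1, hβ.2.1, hβ.2.2.le⟩
  · rw [h.mem_maximizers_iff_inversions, hu, hv]
    rfl

theorem maximizers_inner (h : IsBase W Φ a Δ) (w : W) :
    maximizers W a (innerₗ V (w.1 a)) = {w} := by
  ext v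
  rw [h.mem_maximizers_iff_inner, Set.mem_singleton_iff]
  constructor
  · intro hv
    refine (h.eq_of_separatingRoots_eq_empty (Set.eq_empty_of_forall_notMem ?_)).symm
    exact fun β ⟨hβ, hpos, hneg⟩ => hneg.not_gt (hv β hβ hpos)
  · rintro rfl β - hpos
    exact hpos

theorem separatingRoots_mul_subset (h : IsBase W Φ a Δ) (w : W) {s : W} {α : V} (hα : α ∈ Δ)
    (hs : s.1 = reflAlong α) : separatingRoots Φ (w.1 a) ((w * s).1 a) ⊆ {w.1 α} := by
  have hinv := h.inversions_mul (w := 1) hα hs (h.pos α hα)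
  rw [one_mul, inversions_one, inversions] at hinv
  rw [coe_mul_apply, ← image_separatingRoots h.toIsRootSystem, hinv]
  simp

theorem separatingRoots_subset_of_mem_maximizers (h : IsBase W Φ a Δ) {x y v : W}
    (hv : v ∈ maximizers W a (innerₗ V (x.1 a + y.1 a))) :
    separatingRoots Φ (x.1 a) (v.1 a) ⊆ separatingRoots Φ (x.1 a) (y.1 a) := by
  refine fun β ⟨hβ, hpos, hneg⟩ => ⟨hβ, hpos, ?_⟩
  by_contra! hle
  refine hneg.not_gt (h.mem_maximizers_iff_inner.1 hv β hβ ?_)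
  rw [innerₗ_apply_apply, inner_add_left]
  linarith

theorem eq_of_mem_maximizers_inner_add_inner (h : IsBase W Φ a Δ) {v w s : W} {α : V} (hα : α ∈ Δ)
    (hs : s.1 = reflAlong α) (hv : v ∈ maximizers W a (innerₗ V (w.1 a + (w * s).1 a)))
    (hpos : 0 < ⟪v.1 a, w.1 α⟫) : v = w := by
  refine (h.eq_of_separatingRoots_eq_empty (Set.eq_empty_of_forall_notMem fun β hβ => ?_)).symm
  have hβα := h.separatingRoots_mul_subset w hα hs
    (h.separatingRoots_subset_of_mem_maximizers hv hβ)
  exact hβ.2.2.not_gt (hβα ▸ hpos)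

theorem maximizers_inner_add_inner (h : IsBase W Φ a Δ) (w : W) {s : W} {α : V} (hα : α ∈ Δ)
    (hs : s.1 = reflAlong α) :
    maximizers W a (innerₗ V (w.1 a + (w * s).1 a)) = {w, w * s} := by
  have hsum : ∀ δ, ⟪w.1 a + (w * s).1 a, w.1 δ⟫ = ⟪a, δ⟫ + ⟪a, reflAlong α δ⟫ := fun δ => by
    rw [inner_add_left, coe_mul_apply, LinearIsometryEquiv.inner_map_map,
      LinearIsometryEquiv.inner_map_map, hs, inner_reflAlong]
  have hnonneg : ∀ δ ∈ Δ, 0 ≤ ⟪a, δ⟫ + ⟪a, reflAlong α δ⟫ := fun δ hδ => by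
    rcases eq_or_ne δ α with rfl | hne
    · rw [reflAlong_self, inner_neg_right, add_neg_cancel]
    · exact (add_pos (h.pos δ hδ) (h.inner_reflAlong_pos hα (h.subset hδ) (h.pos δ hδ) hne)).le
  ext v
  simp only [Set.mem_insert_iff, Set.mem_singleton_iff]
  constructor
  · intro hv
    rcases (h.apply_regular v (h.map_mem w (h.subset hα))).lt_or_gt with hneg | hpos
    · refine Or.inr (h.eq_of_mem_maximizers_inner_add_inner (w := w * s) hα hs ?_ ?_)
      · rwa [mul_assoc, mul_self_of_eq_reflAlong hs, mul_one, add_comm]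
      · rwa [coe_mul_apply, hs, reflAlong_self, map_neg, inner_neg_right, neg_pos]
    · exact Or.inl (h.eq_of_mem_maximizers_inner_add_inner hα hs hv hpos)
  · rw [h.mem_maximizers_iff]
    simp only [innerₗ_apply_apply]
    rintro (rfl | rfl) δ hδ
    · rw [hsum]
      exact hnonneg δ hδ
    · rw [coe_mul_apply w s δ, hs, hsum, reflAlong_reflAlong, add_comm]
      exact hnonneg δ hδ

theorem exists_mul_eq_of_maximizers_eq_pair (h : IsBase W Φ a Δ) {f : V →ₗ[ℝ] ℝ} {u v : W}
    (huv : u ≠ v) (hf : maximizers W a f = {u, v}) : ∃ s ∈ simpleReflections W Δ, v = u * s := by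
  have hu : u ∈ maximizers W a f := hf ▸ Set.mem_insert _ _
  have hv : v ∈ maximizers W a f := hf ▸ Set.mem_insert_of_mem _ rfl
  obtain ⟨α, hα, hvα⟩ : ∃ α ∈ Δ, ⟪v.1 a, u.1 α⟫ < 0 := by
    by_contra! hcon
    have hmem := h.mem_maximizers_iff (f := innerₗ V (v.1 a)).2 hcon
    rw [h.maximizers_inner] at hmem
    exact huv hmem
  have hfα : f (u.1 α) = 0 := (h.mem_maximizers_iff.1 hu α hα).antisymm' <|
    le_of_not_gt fun hlt => hvα.not_gt <|
      h.mem_maximizers_iff_inner.1 hv _ (h.map_mem u (h.subset hα)) hlt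
  obtain ⟨s, hsS, hs⟩ := h.exists_simple hα
  obtain ⟨k, -, hus⟩ := h.apply_mul_simple u hα hs
  have hmem : u * s ∈ maximizers W a f := fun w => by
    rw [hus, map_sub, map_smul, hfα, smul_zero, sub_zero]
    exact hu w
  rw [hf] at hmem
  exact ⟨s, hsS, (hmem.resolve_left (h.mul_simple_ne u hα hs)).symm⟩

end IsBase

/-! ### Joins -/

theorem exists_linearMap_eqOn {K M : Type*} [Field K] [AddCommGroup M] [Module K M] {s : Set M}
    (hs : LinearIndepOn K id s) (c : M → K) : ∃ f : M →ₗ[K] K, Set.EqOn f c s := by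
  refine ⟨(Module.Basis.extend hs).constr K fun x => c x, fun x hx => ?_⟩
  simpa using (Module.Basis.extend hs).constr_basis K (fun x => c x)
    ⟨x, hs.subset_extend (Set.subset_univ s) hx⟩

namespace IsBase

open Classical in
theorem exists_nonneg_apply_eq_zero_iff (h : IsBase W Φ a Δ) (I : Set V) :
    ∃ f : V →ₗ[ℝ] ℝ, (∀ δ ∈ Δ, 0 ≤ f δ) ∧ ∀ δ ∈ Δ, f δ = 0 ↔ δ ∈ I := by
  obtain ⟨f, hf⟩ := exists_linearMap_eqOn h.linearIndepOn fun δ => if δ ∈ I then (0 : ℝ) else 1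
  refine ⟨f, fun δ hδ => ?_, fun δ hδ => ?_⟩ <;> rw [hf hδ] <;> by_cases hδI : δ ∈ I <;>
    simp [hδI]

theorem exists_forall_inversions_subset_iff (h : IsBase W Φ a Δ) {u : W} {I : Set V}
    (hI : I ⊆ Δ) (hu : ∀ α ∈ I, 0 < ⟪a, u.1 α⟫) :
    ∃ v : W, ∀ b : W, inversions Φ a v ⊆ inversions Φ a b ↔
      inversions Φ a u ⊆ inversions Φ a b ∧ ∀ α ∈ I, u.1 α ∈ inversions Φ a b := by
  obtain ⟨f, hf, hfI⟩ := h.exists_nonneg_apply_eq_zero_iff I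
  set g : V →ₗ[ℝ] ℝ := f ∘ₗ u⁻¹.1.toLinearMap
  have hgu : ∀ x, g (u.1 x) = f x := fun x => congrArg f (u.1.symm_apply_apply x)
  obtain ⟨v, hv⟩ := h.exists_inversions_eq_le g
  have hug : u ∈ maximizers W a g := h.mem_maximizers_iff.2 fun δ hδ => (hgu δ).symm ▸ hf δ hδ
  refine ⟨v, fun b => ⟨fun hvb => ⟨?_, fun α hα => hvb ?_⟩, fun ⟨hub, hIb⟩ β hβ => ?_⟩⟩
  · exact ((h.mem_maximizers_iff_inversions.1 hug).2.trans hv.ge).trans hvb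
  · rw [hv]
    exact ⟨h.map_mem u (h.subset (hI hα)), hu α hα,
      ((hgu α).trans ((hfI α (hI hα)).2 hα)).le⟩
  · rw [hv] at hβ
    obtain ⟨hβ, hpos, hgβ⟩ := hβ
    by_contra hβb
    have huβ : 0 < ⟪a, u⁻¹.1 β⟫ := by
      rw [← inner_apply_left]
      exact (h.apply_regular u hβ).lt_or_gt.resolve_left fun hneg => hβb (hub ⟨hβ, hpos, hneg⟩)
    have hmem := h.mem_hull _ (h.map_mem u⁻¹ hβ) huβ
    have hzero : f (u⁻¹.1 β) = 0 :=
      le_antisymm hgβ (apply_nonneg_of_mem_hull hf hmem)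
    have hle := apply_nonneg_of_mem_hull (f := -(innerₗ V (b.1 a) ∘ₗ u.1.toLinearMap))
      (fun δ hδ => by simpa using (hIb δ ((hfI δ hδ.1).1 hδ.2)).2.2.le)
      (mem_hull_of_apply_eq_zero hf hmem hzero)
    have hle' : ⟪b.1 a, u.1 (u⁻¹.1 β)⟫ ≤ 0 := by simpa using hle
    rw [apply_inv_apply] at hle'
    exact hβb ⟨hβ, hpos, hle'.lt_of_ne (h.apply_regular b hβ)⟩

theorem exists_isLUB_pair (h : IsBase W Φ a Δ) [PartialOrder W]
    (hle : ∀ u v : W, u ≤ v ↔ RightWeakLE (simpleReflections W Δ) u v) {u x y : W} (hx : u ⋖ x)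
    (hy : u ⋖ y) : ∃ j, IsLUB {x, y} j := by
  obtain ⟨s, ⟨α, hα, hs⟩, rfl, hxlt⟩ := (covBy_iff h.closure_simpleReflections hle).1 hx
  obtain ⟨t, ⟨β, hβ, ht⟩, rfl, hylt⟩ := (covBy_iff h.closure_simpleReflections hle).1 hy
  have huα := h.inner_pos_of_length_lt hα hs hxlt
  have huβ := h.inner_pos_of_length_lt hβ ht hylt
  obtain ⟨j, hj⟩ := h.exists_forall_inversions_subset_iff (u := u) (I := {α, β})
    (by rintro _ (rfl | rfl) <;> assumption) (by rintro _ (rfl | rfl) <;> assumption)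
  refine ⟨j, isLUB_pair_iff.2 fun b => ?_⟩
  simp only [hle, h.rightWeakLE_iff, hj, h.inversions_mul hα hs huα, h.inversions_mul hβ ht huβ,
    Set.insert_subset_iff, Set.mem_insert_iff, Set.mem_singleton_iff, forall_eq_or_imp, forall_eq]
  tauto

end IsBase

/-! ### Faces of the permutahedron -/

section ConvexHull

variable {𝕜 E : Type*} [Field 𝕜] [LinearOrder 𝕜] [IsStrictOrderedRing 𝕜] [AddCommGroup E]
  [Module 𝕜 E]

theorem apply_le_of_mem_convexHull {s : Set E} {f : E →ₗ[𝕜] 𝕜} {m : 𝕜} (hs : ∀ y ∈ s, f y ≤ m)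
    {x : E} (hx : x ∈ convexHull 𝕜 s) : f x ≤ m :=
  convexHull_min hs (convex_halfSpace_le f.isLinear m) hx

theorem mem_convexHull_of_apply_eq {s : Set E} {f : E →ₗ[𝕜] 𝕜} {m : 𝕜} (hs : ∀ y ∈ s, f y ≤ m)
    {x : E} (hx : x ∈ convexHull 𝕜 s) (hxm : f x = m) : x ∈ convexHull 𝕜 {y ∈ s | f y = m} := by
  suffices hsub : convexHull 𝕜 s ⊆ {x | f x ≤ m ∧ (f x = m → x ∈ convexHull 𝕜 {y ∈ s | f y = m})}
    from (hsub hx).2 hxm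
  refine convexHull_min (fun y hy => ⟨hs y hy, fun hym => subset_convexHull 𝕜 _ ⟨hy, hym⟩⟩) ?_
  rw [convex_iff_forall_pos]
  rintro x ⟨hx, hx'⟩ y ⟨hy, hy'⟩ b c hb hc hbc
  have hf : f (b • x + c • y) = b * f x + c * f y := by simp
  have hm : b * m + c * m = m := by rw [← add_mul, hbc, one_mul]
  refine ⟨by rw [hf, ← hm]; gcongr, fun heq => ?_⟩
  rw [hf] at heq
  have hfx : f x = m := hx.antisymm (by nlinarith)
  have hfy : f y = m := hy.antisymm (by nlinarith)
  exact convex_convexHull 𝕜 _ (hx' hfx) (hy' hfy) hb.le hc.le hbc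

end ConvexHull

theorem toExposed_perm {l : StrongDual ℝ V} {w₀ : W} (hw₀ : w₀ ∈ maximizers W a l) :
    l.toExposed (perm W a) = convexHull ℝ ((fun w : W => w.1 a) '' maximizers W a l) := by
  have hle : ∀ y ∈ Set.range fun w : W => w.1 a, l y ≤ l (w₀.1 a) := by
    rintro _ ⟨w, rfl⟩
    exact hw₀ w
  refine subset_antisymm ?_ (convexHull_min ?_
    (ContinuousLinearMap.toExposed.isExposed.convex (convex_convexHull ℝ _)))
  · rintro x ⟨hx, hmax⟩
    have hxw₀ : l x = l (w₀.1 a) :=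
      (apply_le_of_mem_convexHull (f := l.toLinearMap) hle hx).antisymm
        (hmax _ (subset_convexHull ℝ _ ⟨w₀, rfl⟩))
    refine convexHull_mono ?_ (mem_convexHull_of_apply_eq (f := l.toLinearMap) hle hx hxw₀)
    rintro _ ⟨⟨w, rfl⟩, hw⟩
    exact ⟨w, fun w' => (hw₀ w').trans_eq hw.symm, rfl⟩
  · rintro _ ⟨w, hw, rfl⟩
    exact ⟨subset_convexHull ℝ _ ⟨w, rfl⟩, fun y hy =>
      (apply_le_of_mem_convexHull (f := l.toLinearMap) hle hy).trans (hw w₀)⟩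

theorem isFace_maximizers_inner {x : V} (hx : (maximizers W a (innerₗ V x)).Nonempty) :
    IsFace (perm W a) (convexHull ℝ ((fun w : W => w.1 a) '' maximizers W a (innerₗ V x))) := by
  obtain ⟨w, hw⟩ := hx
  refine ⟨⟨_, subset_convexHull ℝ _ ⟨w, hw, rfl⟩⟩, ?_⟩
  have hperm := toExposed_perm (l := innerSL ℝ x) hw
  exact hperm ▸ ContinuousLinearMap.toExposed.isExposed

theorem IsFace.exists_eq_convexHull_maximizers [Finite W] {F : Set V} (hF : IsFace (perm W a) F) :
    ∃ f : V →ₗ[ℝ] ℝ, F = convexHull ℝ ((fun w : W => w.1 a) '' maximizers W a f) := by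
  obtain ⟨hne, hexp⟩ := hF
  obtain ⟨l, rfl⟩ := hexp hne
  obtain ⟨w, hw⟩ := Finite.exists_max fun w : W => l (w.1 a)
  exact ⟨l, toExposed_perm hw⟩

namespace IsBase

theorem injective_apply (h : IsBase W Φ a Δ) : Function.Injective fun w : W => w.1 a :=
  fun u v (huv : u.1 a = v.1 a) => h.inversions_injective (by rw [inversions, inversions, huv])

theorem apply_mem_convexHull_iff (h : IsBase W Φ a Δ) {T : Set W} {w : W} :
    w.1 a ∈ convexHull ℝ ((fun w : W => w.1 a) '' T) ↔ w ∈ T := by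
  refine ⟨fun hw => ?_, fun hw => subset_convexHull ℝ _ ⟨w, hw, rfl⟩⟩
  have hmax : w ∈ maximizers W a (innerₗ V (w.1 a)) := (h.maximizers_inner w).ge rfl
  have hface := mem_convexHull_of_apply_eq (f := innerₗ V (w.1 a))
    (by rintro _ ⟨w', -, rfl⟩; exact hmax w') hw rfl
  obtain ⟨_, ⟨v, hv, rfl⟩, hvw⟩ := convexHull_nonempty_iff.1 ⟨_, hface⟩
  have hvmax : v ∈ maximizers W a (innerₗ V (w.1 a)) := fun w' => (hmax w').trans_eq hvw.symm
  rw [h.maximizers_inner, Set.mem_singleton_iff] at hvmax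
  exact hvmax ▸ hv

theorem exists_equiv_exposedPoints (h : IsBase W Φ a Δ) :
    ∃ e : W ≃ (perm W a).exposedPoints ℝ, ∀ w : W, (e w : V) = w.1 a := by
  have := h.finite_group
  have hmem : ∀ w : W, w.1 a ∈ (perm W a).exposedPoints ℝ := fun w => by
    have hw := h.maximizers_inner w
    have hface := isFace_maximizers_inner ⟨w, hw.ge rfl⟩
    rw [hw, Set.image_singleton, convexHull_singleton] at hface
    exact mem_exposedPoints_iff_exposed_singleton.2 hface.2
  refine ⟨Equiv.ofBijective (fun w => ⟨w.1 a, hmem w⟩)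
    ⟨fun u v huv => h.injective_apply (congrArg Subtype.val huv), ?_⟩, fun w => rfl⟩
  rintro ⟨x, hx⟩
  rw [mem_exposedPoints_iff_exposed_singleton] at hx
  obtain ⟨f, hf⟩ := IsFace.exists_eq_convexHull_maximizers (W := W) ⟨Set.singleton_nonempty x, hx⟩
  obtain ⟨_, w, hw, rfl⟩ := convexHull_nonempty_iff.1 (hf ▸ Set.singleton_nonempty x)
  exact ⟨w, Subtype.ext (hf.ge (subset_convexHull ℝ _ ⟨w, hw, rfl⟩))⟩

theorem isEdge_iff (h : IsBase W Φ a Δ) {u v : W} :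
    IsEdge (perm W a) (segment ℝ (u.1 a) (v.1 a)) ↔ ∃ s ∈ simpleReflections W Δ, v = u * s := by
  have := h.finite_group
  constructor
  · rintro ⟨hface, hdim⟩
    have hne : u ≠ v := by
      rintro rfl
      rw [segment_same, vectorSpan_singleton, finrank_bot] at hdim
      exact zero_ne_one hdim
    obtain ⟨f, hf⟩ := hface.exists_eq_convexHull_maximizers
    refine h.exists_mul_eq_of_maximizers_eq_pair (f := f) hne (Set.ext fun w => ?_)
    rw [← convexHull_pair, ← Set.image_pair (fun w : W => w.1 a)] at hf
    rw [← h.apply_mem_convexHull_iff, ← hf, h.apply_mem_convexHull_iff]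
  · rintro ⟨s, ⟨α, hα, hs⟩, rfl⟩
    have hpair := h.maximizers_inner_add_inner u hα hs
    constructor
    · have hface := isFace_maximizers_inner ⟨u, hpair.ge (Set.mem_insert _ _)⟩
      rwa [hpair, Set.image_pair, convexHull_pair] at hface
    · rw [vectorSpan_segment]
      exact finrank_span_singleton (vsub_ne_zero.2 (h.injective_apply.ne (h.mul_simple_ne u hα hs)))

end IsBase

/-! ### The weak order and the 1-skeleton -/

namespace IsBase

theorem exists_lattice (h : IsBase W Φ a Δ) :
    ∃ _ : Lattice W, ∀ u v : W, u ≤ v ↔ RightWeakLE (simpleReflections W Δ) u v := by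
  have := h.finite_group
  let _ : PartialOrder W := PartialOrder.lift (inversions Φ a) h.inversions_injective
  have hle : ∀ u v : W, u ≤ v ↔ RightWeakLE (simpleReflections W Δ) u v := fun _ _ =>
    h.rightWeakLE_iff.symm
  let _ : OrderBot W :=
    { bot := 1, bot_le := fun w => inversions_one.trans_subset (Set.empty_subset _) }
  choose sup hsup using exists_isLUB_of_covBy fun u x y : W => h.exists_isLUB_pair hle (u := u)
  let _ : SupSet W := ⟨sup⟩
  exact ⟨(completeLatticeOfSup W hsup).toLattice, hle⟩

theorem exists_forall_inversions_subset (h : IsBase W Φ a Δ) :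
    ∃ wo : W, ∀ w : W, inversions Φ a w ⊆ inversions Φ a wo := by
  obtain ⟨wo, hwo⟩ := h.exists_inversions_eq_le 0
  exact ⟨wo, fun w β ⟨hβ, hpos, _⟩ => hwo ▸ ⟨hβ, hpos, le_rfl⟩⟩

theorem length_ne_length_mul (h : IsBase W Φ a Δ) (u : W) {s : W}
    (hs : s ∈ simpleReflections W Δ) :
    length (simpleReflections W Δ) u ≠ length (simpleReflections W Δ) (u * s) := by
  obtain ⟨α, hα, hs⟩ := hs
  rcases (h.regular _ (h.map_mem u (h.subset hα))).lt_or_gt with hneg | hpos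
  · exact (h.length_mul_lt hα hs hneg).ne'
  · rw [h.length_eq_ncard_inversions, h.length_eq_ncard_inversions,
      h.ncard_inversions_mul hα hs hpos]
    exact (Nat.succ_ne_self _).symm

theorem exists_interval_of_isFace (h : IsBase W Φ a Δ) {F : Set V} (hF : IsFace (perm W a) F) :
    ∃ u v : W, RightWeakLE (simpleReflections W Δ) u v ∧
      {w : W | w.1 a ∈ F} = {w | RightWeakLE (simpleReflections W Δ) u w ∧
        RightWeakLE (simpleReflections W Δ) w v} ∧
      F = convexHull ℝ ((fun w : W => w.1 a) '' {w : W | w.1 a ∈ F}) := by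
  have := h.finite_group
  obtain ⟨f, hf⟩ := hF.exists_eq_convexHull_maximizers
  obtain ⟨u, v, huv, hmax⟩ := h.exists_maximizers_eq f
  have hmem : {w : W | w.1 a ∈ F} = maximizers W a f :=
    Set.ext fun w => by rw [hf]; exact h.apply_mem_convexHull_iff
  refine ⟨u, v, h.rightWeakLE_iff.2 huv, ?_, hmem ▸ hf⟩
  simp only [hmem, hmax, h.rightWeakLE_iff]

end IsBase

end CoxeterPerm

open CoxeterPerm in
theorem mainTheorem4_general {V : Type*} [NormedAddCommGroup V] [InnerProductSpace ℝ V]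
    (W : Subgroup (V ≃ₗᵢ[ℝ] V)) (Φ : Set V) (hΦ : IsRootSystem W Φ) (a : V) (ha : IsGeneric W a)
    (Δ : Set V) (hΔ : IsSimpleSystem Φ Δ) (haΔ : ∀ α ∈ Δ, 0 < inner ℝ a α) :
    ∃ _ : Lattice W, (∀ u v : W, u ≤ v ↔ RightWeakLE (simpleReflections W Δ) u v) ∧
      (∃ e : W ≃ (perm W a).exposedPoints ℝ, (∀ w : W, (e w : V) = (w : V ≃ₗᵢ[ℝ] V) a) ∧
        (∀ u v : W, (oneSkeleton (perm W a)).Adj (e u) (e v) →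
          length (simpleReflections W Δ) u ≠ length (simpleReflections W Δ) v) ∧
        (∀ u v : W, ((oneSkeleton (perm W a)).Adj (e u) (e v) ∧
          length (simpleReflections W Δ) u < length (simpleReflections W Δ) v) ↔ u ⋖ v)) ∧
      (∀ w : W, 1 ≤ w) ∧
      (∃ wo : W, (∀ w : W, w ≤ wo) ∧ ∀ w : W, w ≠ wo →
        length (simpleReflections W Δ) w < length (simpleReflections W Δ) wo) ∧
      (∀ F : Set V, IsFace (perm W a) F → ∃ u v : W, u ≤ v ∧
        {w : W | (w : V ≃ₗᵢ[ℝ] V) a ∈ F} = Set.Icc u v ∧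
        F = convexHull ℝ ((fun w : W => (w : V ≃ₗᵢ[ℝ] V) a) '' Set.Icc u v)) := by
  have h := hΦ.isBase ha hΔ haΔ
  have hS := h.closure_simpleReflections
  obtain ⟨L, hle⟩ := h.exists_lattice
  obtain ⟨e, he⟩ := h.exists_equiv_exposedPoints
  obtain ⟨wo, hwo⟩ := h.exists_forall_inversions_subset
  have hadj (u v : W) : (oneSkeleton (perm W a)).Adj (e u) (e v) ↔
      ∃ s ∈ simpleReflections W Δ, v = u * s := by
    rw [← h.isEdge_iff, ← he, ← he]
    rfl
  have htop (w : W) : w ≤ wo := (hle w wo).2 (h.rightWeakLE_iff.2 (hwo w))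
  refine ⟨L, hle, ⟨e, he, fun u v huv => ?_, fun u v => ?_⟩, fun w => ?_,
    ⟨wo, htop, fun w hw => length_lt_length hS hle ((htop w).lt_of_ne hw)⟩, fun F hF => ?_⟩
  · obtain ⟨s, hs, rfl⟩ := (hadj u v).1 huv
    exact h.length_ne_length_mul u hs
  · rw [hadj, covBy_iff hS hle]
    tauto
  · exact (hle 1 w).2 ⟨w, (one_mul w).symm, by simp⟩
  · obtain ⟨u, v, huv, hIcc, hF⟩ := h.exists_interval_of_isFace hF
    have hIcc : {w : W | w.1 a ∈ F} = Set.Icc u v := by simp only [hIcc, ← hle]; rfl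
    exact ⟨u, v, (hle u v).2 huv, hIcc, hIcc ▸ hF⟩

theorem mainTheorem4 {V : Type*} [NormedAddCommGroup V] [InnerProductSpace ℝ V]
    [FiniteDimensional ℝ V] (W : Subgroup (V ≃ₗᵢ[ℝ] V)) [Finite W]
    (hW : CoxeterPerm.IsReflectionGroup W)
    (Φ : Set V) (hΦ : CoxeterPerm.IsRootSystem W Φ)
    (a : V) (ha : CoxeterPerm.IsGeneric W a)
    (Δ : Set V) (hΔ : CoxeterPerm.IsSimpleSystem Φ Δ) (haΔ : ∀ α ∈ Δ, 0 < inner ℝ a α)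
    (S : Set W) (hS : S = CoxeterPerm.simpleReflections W Δ)
    (P : Set V) (hP : P = CoxeterPerm.perm W a) :
    -- the right weak order is (a partial order and) a lattice on `W`
    ∃ L : Lattice W, (∀ u v : W, u ≤ v ↔ CoxeterPerm.RightWeakLE S u v) ∧
      -- `w ↦ w(a)` identifies `W` with the vertices; every edge has endpoints of different length,
      -- and the edges oriented by increasing length are exactly the cover relations
      (∃ e : W ≃ P.exposedPoints ℝ, (∀ w : W, (e w : V) = (w : V ≃ₗᵢ[ℝ] V) a) ∧
        (∀ u v : W, (CoxeterPerm.oneSkeleton P).Adj (e u) (e v) →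
          CoxeterPerm.length S u ≠ CoxeterPerm.length S v) ∧
        (∀ u v : W, ((CoxeterPerm.oneSkeleton P).Adj (e u) (e v) ∧
          CoxeterPerm.length S u < CoxeterPerm.length S v) ↔ u ⋖ v)) ∧
      -- the minimum is the identity
      (∀ w : W, 1 ≤ w) ∧
      -- there is a maximum `wo`, which is the unique longest element
      (∃ wo : W, (∀ w : W, w ≤ wo) ∧
        ∀ w : W, w ≠ wo → CoxeterPerm.length S w < CoxeterPerm.length S wo) ∧
      -- the vertices of each nonempty face form an interval, and the face is their convex hull
      (∀ F : Set V, CoxeterPerm.IsFace P F → ∃ u v : W, u ≤ v ∧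
        {w : W | (w : V ≃ₗᵢ[ℝ] V) a ∈ F} = Set.Icc u v ∧
        F = convexHull ℝ ((fun w : W => (w : V ≃ₗᵢ[ℝ] V) a) '' Set.Icc u v)) := by
  subst hS hP
  exact mainTheorem4_general W Φ hΦ a ha Δ hΔ haΔ
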